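/- **Setting.** Let $K$ be a finite simplicial complex, $f:K\to\mathbb R$ a function with $f(\sigma)\le f(\tau)$ whenever $\sigma$ is a face of $\tau$, and let the simplices of $K$ be totally ordered by $f$-value, ties being broken so that faces precede their cofaces. Fix a field of coefficients and $p\ge 0$, and let $D_p$ be the boundary matrix whose columns are the $p$-simplices and whose rows are the $(p-1)$-simplices, in this order. For a matrix $R$, let $\operatorname{low}R[\cdot,\tau]$ be the row of the lowest non-zero entry of column $\tau$ (if the column is non-zero); $R$ is *reduced* if its non-zero columns have distinct lows. For a given order of the $p$-simplices, $\sigma$ is *paired with* $\tau$ if $\operatorname{low}R[\cdot,\tau]=\sigma$ for some decomposition $R=D_pV$ with $R$ reduced and $V$ invertible and upper-triangular for that order. *Lazy reduction.* Start from $R_p=D_p$, $V_p=U_p=I$. For each column $\tau_j$ in order, as long as column $\tau_j$ of $R_p$ is non-zero and some $\tau_i<\tau_j$ has the same low, $\sigma$ say, put $\alpha=R_p[\sigma,\tau_j]/R_p[\sigma,\tau_i]$, subtract $\alpha$ times column $\tau_i$ from column $\tau_j$ in both $R_p$ and $V_p$, and add $\alpha$ times row $\tau_j$ to row $\tau_i$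 in $U_p$. *Transposition procedure.* Let $\tau$ be a $p$-simplex paired with $\sigma$ in the given order, $d=f(\tau)$ and $d'\ge d$. Start with the block $X=\{\tau\}$. For each $p$-simplex $\tau_k$ after $\tau$ with $d\le f(\tau_k)\le d'$, in order, transpose $\tau_k$ past all of $X$, to just before it. If $\tau_k$ becomes paired with $\sigma$, add it to $X$ and return it to the far end of $X$; otherwise leave it before $X$. **Theorem.** Let $R_p,V_p,U_p$ come from the lazy reduction, and let $X_\sigma$ be the set gathered by the transposition procedure as the value of $\tau$ is increased from $d$ to $d'$. Then: 1. $X_\sigma=\{\tau_i \mid \tau_i \text{ a } p\text{-simplex},\ d\le f(\tau_i)\le d',\ U_p[\tau,\tau_i]\ne 0\}$. 2. $X_\sigma$ is critical in the final order: for every rearrangement of the contiguous block $X_\sigma$, the first simplex of the block is paired with $\sigma$. 3. When the procedure treats $\tau_k$, for every order of the block $X$ collected so far, $\tau_k$ is paired with $\sigma$ after being transposed past $X$ if and only if $U_p[\tau,\tau_k]\ne0$. So a single order of $X$, or just the entry of $U_p$, decides, with no need to examine all orders. 4. $X_\sigma$ is read off the single row $U_p[\tau,\cdot]$ in linear time: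 scanning the $p$-simplices in order from $\tau$ on, until a value exceeds $d'$ or none is left, and keeping those with a non-zero entry in the row, outputs exactly $X_\sigma$, without repetition, after at most $4m_p+2$ elementary operations (fetching the next simplex, comparing its value with $d'$, testing its entry in the row, appending it to the output), where $m_p$ is the number of $p$-simplices with value in $[d,d']$. -/

import Mathlib

namespace Persistence

noncomputable section

/-! ### Column operations, lowest entries and persistence pairs

Rows are indexed by a linearly ordered type `ρ` and columns by `κ`.
-/

section Reduction

variable {ρ κ 𝕜 : Type*} [LinearOrder ρ] [Fintype κ] [LinearOrder κ] [Field 𝕜]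

/-- `low (col R τ) = σ`: the lowest non-zero entry of the column `τ` of `R` is in row `σ`.
A zero column has no lowest entry. -/
def IsLow (R : Matrix ρ κ 𝕜) (σ : ρ) (τ : κ) : Prop :=
  R σ τ ≠ 0 ∧ ∀ σ', σ < σ' → R σ' τ = 0

/-- The lowest non-zero entries of the non-zero columns are in pairwise distinct rows. -/
def IsReduced (R : Matrix ρ κ 𝕜) : Prop :=
  ∀ σ τ τ', IsLow R σ τ → IsLow R σ τ' → τ = τ'

/-- `σ` is paired with `τ` when the columns of `D` are put in the order `cols` (a list that
enumerates all columns once): there is a decomposition `R = D * V` with `V` invertible and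
upper-triangular for that order, `R` reduced, and `low (col R τ) = σ`. -/
def Paired (D : Matrix ρ κ 𝕜) (cols : List κ) (σ : ρ) (τ : κ) : Prop :=
  ∃ V : Matrix κ κ 𝕜, IsUnit V ∧ V.BlockTriangular (fun c => cols.idxOf c) ∧
    IsReduced (D * V) ∧ IsLow (D * V) σ τ

/-- All columns, listed in their given linear order. -/
def columns (κ : Type*) [Fintype κ] [LinearOrder κ] : List κ :=
  (Finset.univ : Finset κ).sort (· ≤ ·)

/-- The three matrices maintained by the lazy reduction. -/
structure Matrices (ρ κ 𝕜 : Type*) where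
  R : Matrix ρ κ 𝕜
  V : Matrix κ κ 𝕜
  U : Matrix κ κ 𝕜

/-- One pass through the body of the while-loop: with `α = R[σ, j] / R[σ, i]`, subtract `α` times
column `i` from column `j` in `R` and in `V`, and add `α` times row `j` to row `i` in `U`. -/
def Matrices.addColumn (M : Matrices ρ κ 𝕜) (σ : ρ) (i j : κ) : Matrices ρ κ 𝕜 where
  R := M.R.updateCol j (fun s => M.R s j - M.R σ j / M.R σ i * M.R s i)
  V := M.V.updateCol j (fun k => M.V k j - M.R σ j / M.R σ i * M.V k i)
  U := M.U.updateRow i (fun k => M.U i k + M.R σ j / M.R σ i * M.U j k)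

/-- `WhileLoop j M M'`: the while-loop for column `j`, started at `M`, terminates at `M'`. It runs
as long as column `j` of `R` is non-zero and has the same lowest row as some earlier column. -/
inductive WhileLoop (j : κ) : Matrices ρ κ 𝕜 → Matrices ρ κ 𝕜 → Prop
  | done (M : Matrices ρ κ 𝕜) (h : ¬ ∃ i σ, i < j ∧ IsLow M.R σ i ∧ IsLow M.R σ j) :
      WhileLoop j M M
  | step (M M' : Matrices ρ κ 𝕜) (i : κ) (σ : ρ) (hij : i < j) (hi : IsLow M.R σ i)
      (hj : IsLow M.R σ j) (h : WhileLoop j (M.addColumn σ i j) M') : WhileLoop j M M'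

/-- `ForLoop l M M'`: treating the columns of `l` one after the other takes `M` to `M'`. -/
inductive ForLoop : List κ → Matrices ρ κ 𝕜 → Matrices ρ κ 𝕜 → Prop
  | nil (M : Matrices ρ κ 𝕜) : ForLoop [] M M
  | cons (j : κ) (l : List κ) (M M' M'' : Matrices ρ κ 𝕜) (h : WhileLoop j M M')
      (h' : ForLoop l M' M'') : ForLoop (j :: l) M M''

/-- `M` is the output of the lazy reduction of `D`, which starts from `R = D`, `V = U = 1` and
treats the columns in their order. -/
def IsLazyReduction (D : Matrix ρ κ 𝕜) (M : Matrices ρ κ 𝕜) : Prop :=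
  ForLoop (columns κ) ⟨D, 1, 1⟩ M

/-- The while-loop terminates, because each pass moves the lowest entry up. -/
theorem exists_whileLoop [Finite ρ] (j : κ) (M : Matrices ρ κ 𝕜) : ∃ M', WhileLoop j M M' := by
  classical
  have := Fintype.ofFinite ρ
  obtain ⟨n, hn⟩ : ∃ n, n = (Finset.univ.filter (fun s : ρ => ∃ s', s ≤ s' ∧ M.R s' j ≠ 0)).card :=
    ⟨_, rfl⟩
  induction n using Nat.strong_induction_on generalizing M with
  | _ n ih =>
    by_cases h : ∃ i σ, i < j ∧ IsLow M.R σ i ∧ IsLow M.R σ j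
    · obtain ⟨i, σ, hij, hi, hj⟩ := h
      have key : ∀ s', σ ≤ s' → (M.addColumn σ i j).R s' j = 0 := by
        intro s' hs
        rcases hs.eq_or_lt with rfl | hs
        · simp [Matrices.addColumn, div_mul_cancel₀ _ hi.1]
        · simp [Matrices.addColumn, hi.2 _ hs, hj.2 _ hs]
      have hlt : (Finset.univ.filter
          (fun s : ρ => ∃ s', s ≤ s' ∧ (M.addColumn σ i j).R s' j ≠ 0)).card < n := by
        rw [hn]
        apply Finset.card_lt_card
        rw [Finset.ssubset_iff]
        refine ⟨σ, ?_, ?_⟩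
        · simp only [Finset.mem_filter, Finset.mem_univ, true_and]
          rintro ⟨s', h1, h2⟩
          exact h2 (key s' h1)
        · intro s hs
          simp only [Finset.mem_insert, Finset.mem_filter, Finset.mem_univ, true_and] at hs ⊢
          rcases hs with rfl | ⟨s', h1, h2⟩
          · exact ⟨s, le_rfl, hj.1⟩
          · refine ⟨σ, ?_, hj.1⟩
            by_contra hc
            exact h2 (key s' ((not_le.mp hc).le.trans h1))
      obtain ⟨M', h'⟩ := ih _ hlt (M.addColumn σ i j) rfl
      exact ⟨M', .step M M' i σ hij hi hj h'⟩
    · exact ⟨M, .done M h⟩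

/-- The lazy reduction terminates. -/
theorem exists_isLazyReduction [Finite ρ] (D : Matrix ρ κ 𝕜) : ∃ M, IsLazyReduction D M := by
  have (l : List κ) : ∀ M : Matrices ρ κ 𝕜, ∃ M', ForLoop l M M' := by
    induction l with
    | nil => exact fun M => ⟨M, .nil M⟩
    | cons j l ih =>
      intro M
      obtain ⟨M', h⟩ := exists_whileLoop j M
      obtain ⟨M'', h'⟩ := ih M'
      exact ⟨M'', .cons j l M M' M'' h h'⟩
  exact this _ _
/-! ### Moving `τ` up by transpositions -/

/-- The order of the columns while `τ` moves up: first the columns in `before`, then the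
contiguous block `crit`, the critical set collected so far, then the columns in `after`. -/
structure Sweep (κ : Type*) where
  before : List κ
  crit : List κ
  after : List κ

/-- The column order in which the critical block is listed as `L` and `t`, which comes from
`after`, has been transposed past the whole block. -/
def Sweep.past (S : Sweep κ) (t : κ) (L : List κ) : List κ :=
  S.before ++ t :: (L ++ S.after.erase t)

/-- Initially the columns are in their given order and the critical set is `{τ}`. -/
def Sweep.start (τ : κ) : Sweep κ where
  before := (columns κ).filter (fun t => t < τ)
  crit := [τ]
  after := (columns κ).filter (fun t => τ < t)

open Classical in
/-- One pass through the loop for the column `t`: transpose `t` with each simplex of the critical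
block. If `t` becomes paired with `σ`, add it to the critical set and return it to the far end of
the block; otherwise leave it in front of the block. -/
def Sweep.step (D : Matrix ρ κ 𝕜) (σ : ρ) (S : Sweep κ) (t : κ) : Sweep κ :=
  if Paired D (S.past t S.crit) σ t then
    { before := S.before, crit := S.crit ++ [t], after := S.after.erase t }
  else
    { before := S.before ++ [t], crit := S.crit, after := S.after.erase t }

/-- The columns that `τ` meets when its value is raised from `f τ` to `d'`, in order. -/
def met (f : κ → ℝ) (τ : κ) (d' : ℝ) : List κ :=
  (columns κ).filter (fun t => τ < t ∧ f τ ≤ f t ∧ f t ≤ d')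

/-- The state of the transposition procedure after the columns in `l` have been treated. -/
def Sweep.run (D : Matrix ρ κ 𝕜) (σ : ρ) (τ : κ) (l : List κ) : Sweep κ :=
  l.foldl (Sweep.step D σ) (Sweep.start τ)

/-- The block of `S` is critical: whenever it is rearranged, its first simplex is paired
with `σ`. -/
def Sweep.IsCritical (D : Matrix ρ κ 𝕜) (σ : ρ) (S : Sweep κ) : Prop :=
  ∀ (x : κ) (L : List κ), (x :: L).Perm S.crit → Paired D (S.before ++ (x :: L) ++ S.after) σ x

end Reduction

/-! ### Scanning one row, with a step count -/

/-- The states of the scan of a row. `todo` holds the columns still to be scanned and `out` the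
columns selected so far. -/
inductive Scan (κ : Type*)
  | next (todo out : List κ)
  | compare (t : κ) (todo out : List κ)
  | test (t : κ) (todo out : List κ)
  | push (t : κ) (todo out : List κ)
  | halt (out : List κ)

open Classical in
/-- A single step of the scan of the row `u` is one elementary operation: fetch the next column,
compare its value with `d'`, test its entry in the row for zero, or append it to the output. -/
def Scan.step {κ 𝕜 : Type*} [Zero 𝕜] (f : κ → ℝ) (d' : ℝ) (u : κ → 𝕜) : Scan κ → Scan κ
  | .next [] out => .halt out
  | .next (t :: todo) out => .compare t todo out
  | .compare t todo out => if f t ≤ d' then .test t todo out else .halt out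
  | .test t todo out => if u t ≠ 0 then .push t todo out else .next todo out
  | .push t todo out => .next todo (t :: out)
  | .halt out => .halt out

/-! ### Filtered simplicial complexes and their boundary matrices -/

section Complex

variable {V : Type*}

/-- A function on the simplices of `K` that respects the face relation, and the simplices of `K`
sorted by its values, with faces before their cofaces. -/
structure Filtration (K : PreAbstractSimplicialComplex V) where
  f : K → ℝ
  f_mono : ∀ σ τ : K, σ.1 ⊆ τ.1 → f σ ≤ f τ
  n : ℕ
  simplex : Fin n ≃ K
  sorted : ∀ i j, i ≤ j → f (simplex i) ≤ f (simplex j)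
  faces_first : ∀ i j, (simplex i).1 ⊂ (simplex j).1 → i < j

variable {K : PreAbstractSimplicialComplex V}

/-- The simplices of `K` with `c` vertices, that is, of dimension `c - 1`. -/
def Filtration.Cell (_ : Filtration K) (c : ℕ) : Type _ := {s : K // s.1.card = c}

/-- The simplices of one dimension, in filtration order. -/
instance (F : Filtration K) (c : ℕ) : LinearOrder (F.Cell c) :=
  LinearOrder.lift' (fun s => F.simplex.symm s.1)
    (fun _ _ h => Subtype.ext (F.simplex.symm.injective h))

instance (F : Filtration K) (c : ℕ) : Fintype (F.Cell c) :=
  haveI : Finite K := Finite.of_equiv _ F.simplex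
  haveI : Finite (F.Cell c) := inferInstanceAs (Finite {s : K // s.1.card = c})
  Fintype.ofFinite _

/-- The value of a simplex. -/
def Filtration.val (F : Filtration K) {c : ℕ} (s : F.Cell c) : ℝ := F.f s.1

/-- The boundary matrix `D_p`: columns are indexed by the `p`-simplices `τ = {v₀ < ⋯ < v_p}`, rows
by the `(p - 1)`-simplices, and the boundary of `τ` is the sum of `(-1) ^ i (τ \ {v_i})`. -/
def Filtration.boundary [LinearOrder V] (F : Filtration K) (𝕜 : Type*) [Field 𝕜] (p : ℕ) :
    Matrix (F.Cell p) (F.Cell (p + 1)) 𝕜 :=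
  fun σ τ => ∑ v ∈ τ.1.1, if σ.1.1 = τ.1.1.erase v
    then (-1) ^ (τ.1.1.filter (fun w => w < v)).card else 0

end Complex

end

end Persistence

/-!
Pairing is a matter of spans: `σ` is paired with `t` exactly when some linear combination of the
columns up to `t` has its lowest non-zero entry in row `σ`, and no combination of the columns
strictly before `t` does (`isLow_mul_iff`, `paired_append_cons_iff`). In particular it depends only
on `t` and on the set of columns in front of it, not on how these, or the later ones, are ordered.

The lazy reduction ends with `D = R * U`, where `U` is upper unitriangular and, by laziness, the low
of column `i` of `R` lies strictly below all non-zero entries of column `k` of `R` whenever `i < k`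
and `U i k ≠ 0` (`LazyInvariant`). Let `R` have low `σ` in column `τ`.

* A combination of columns `c` of `D` with `U τ c = 0` is a combination of columns of `R` other than
  `τ`, so its low is not `σ` (`LazyInvariant.not_hasLow`).
* Suppose `U τ t ≠ 0`, and expand column `t` of `D` in columns of `R`. By laziness the columns of
  `R` that reach below row `σ` are combinations of columns `c` of `D` with `U τ c = 0`
  (`LazyInvariant.inv_apply_eq_zero`), so they can be removed with such columns, at the positions
  before `t`. What is left has low `σ`, because column `τ` of `R` occurs in it and no other column
  has that low (`LazyInvariant.hasLow`).

Hence, when the columns in front of `t` are zeros of row `τ` of `U`, and include all zeros before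
`t` in the original order, `t` is paired with `σ` if and only if `U τ t ≠ 0`
(`LazyInvariant.paired_iff`). The transposition procedure maintains exactly this situation, since it
leaves the zeros of the row in front of the block and gathers the others in it
(`LazyInvariant.run_eq_predicted`). In the final order the same criterion applies to whichever
simplex comes first in the block, as the block holds only simplices with a non-zero entry.
-/

set_option linter.unusedSectionVars false

namespace Persistence

/-! ### Lows of linear combinations of columns -/

section Pairing

variable {ρ κ 𝕜 α : Type*} [LinearOrder ρ] [Fintype κ] [LinearOrder κ] [Field 𝕜] [LinearOrder α]

/-- The lowest non-zero entry of the vector `w` is in row `σ`. -/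
def IsLowVec (w : ρ → 𝕜) (σ : ρ) : Prop :=
  w σ ≠ 0 ∧ ∀ σ', σ < σ' → w σ' = 0

/-- Some linear combination of the columns of `D` indexed by `A` has its lowest non-zero entry in
row `σ`. -/
def HasLow (D : Matrix ρ κ 𝕜) (A : Set κ) (σ : ρ) : Prop :=
  ∃ v : κ → 𝕜, (∀ k, k ∉ A → v k = 0) ∧ IsLowVec (D.mulVec v) σ

theorem IsLowVec.unique {w : ρ → 𝕜} {σ σ' : ρ} (h : IsLowVec w σ) (h' : IsLowVec w σ') :
    σ = σ' := by
  rcases lt_trichotomy σ σ' with hl | hl | hl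
  · exact absurd (h.2 _ hl) h'.1
  · exact hl
  · exact absurd (h'.2 _ hl) h.1

theorem exists_isLowVec [Finite ρ] {w : ρ → 𝕜} (h : w ≠ 0) : ∃ σ, IsLowVec w σ := by
  classical
  obtain ⟨s, hs⟩ := Function.ne_iff.mp h
  obtain ⟨σ, hσ⟩ := (Set.toFinite {s | w s ≠ 0}).exists_maximal ⟨s, hs⟩
  refine ⟨σ, hσ.1, fun σ' hlt => ?_⟩
  by_contra hne
  exact (hσ.2 hne hlt.le).not_gt hlt

theorem HasLow.mono {D : Matrix ρ κ 𝕜} {A B : Set κ} (hAB : A ⊆ B) {σ : ρ} (h : HasLow D A σ) :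
    HasLow D B σ := by
  obtain ⟨v, hv, hl⟩ := h
  exact ⟨v, fun k hk => hv k (fun hA => hk (hAB hA)), hl⟩

/-- In a linear combination of the columns of a reduced matrix the lows cannot cancel: the low of
the combination is the low of one of the columns that occur in it. -/
theorem IsReduced.exists_isLow [Finite ρ] {R : Matrix ρ κ 𝕜} (hR : IsReduced R) {v : κ → 𝕜}
    {σ : ρ} (h : IsLowVec (R.mulVec v) σ) : ∃ j, v j ≠ 0 ∧ IsLow R σ j := by
  classical
  have hne : {s | ∃ j, v j ≠ 0 ∧ IsLow R s j}.Nonempty := by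
    obtain ⟨j, -, hj⟩ := Finset.exists_ne_zero_of_sum_ne_zero h.1
    have hcol : (fun s => R s j) ≠ 0 := fun h0 => left_ne_zero_of_mul hj (congrFun h0 σ)
    obtain ⟨s, hs⟩ := exists_isLowVec hcol
    exact ⟨s, j, right_ne_zero_of_mul hj, hs⟩
  obtain ⟨s, ⟨j, hvj, hj⟩, hmax⟩ := (Set.toFinite _).exists_maximal hne
  have hzero : ∀ k s', v k ≠ 0 → s < s' → R s' k = 0 := by
    intro k s' hk hlt
    by_contra h0
    have hcol : (fun s => R s k) ≠ 0 := fun h' => h0 (congrFun h' s')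
    obtain ⟨q, hq⟩ := exists_isLowVec hcol
    have hs'q : s' ≤ q := by
      by_contra hc
      exact h0 (hq.2 _ (not_le.mp hc))
    exact (hmax ⟨k, hk, hq⟩ (hlt.le.trans hs'q)).not_gt (hlt.trans_le hs'q)
  have hlow : IsLowVec (R.mulVec v) s := by
    refine ⟨?_, fun s' hs' => Finset.sum_eq_zero fun k _ => ?_⟩
    · have : R.mulVec v s = R s j * v j := by
        refine Finset.sum_eq_single j (fun k _ hkj => ?_) (by simp)
        by_cases hk : v k = 0
        · simp [hk]
        · have : R s k = 0 := by
            by_contra h0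
            exact hkj (hR s k j ⟨h0, fun s' hs' => hzero k s' hk hs'⟩ hj)
          simp [this]
      rw [this]
      exact mul_ne_zero hj.1 hvj
    · by_cases hk : v k = 0
      · simp [hk]
      · simp [hzero k s' hk hs']
  rw [h.unique hlow]
  exact ⟨j, hvj, hj⟩

theorem isLowVec_mulVec_single {R : Matrix ρ κ 𝕜} {σ : ρ} {j : κ} :
    IsLowVec (R.mulVec (Pi.single j 1)) σ ↔ IsLow R σ j := by
  simp [IsLowVec, IsLow]

/-- A triangular matrix maps vectors supported on a lower set to such vectors. -/
theorem _root_.Matrix.BlockTriangular.mulVec_eq_zero {b : κ → α} {V : Matrix κ κ 𝕜}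
    (hV : V.BlockTriangular b) {A : Set κ} (hA : ∀ i j, b i ≤ b j → j ∈ A → i ∈ A) {v : κ → 𝕜}
    (hv : ∀ k, k ∉ A → v k = 0) : ∀ k, k ∉ A → V.mulVec v k = 0 := by
  intro k hk
  refine Finset.sum_eq_zero fun j _ => ?_
  by_cases hj : j ∈ A
  · have : V k j = 0 := hV (not_le.mp fun hle => hk (hA k j hle hj))
    simp [this]
  · simp [hv j hj]

theorem _root_.Matrix.BlockTriangular.inv {b : κ → α} {V : Matrix κ κ 𝕜}
    (hV : V.BlockTriangular b) : V⁻¹.BlockTriangular b := by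
  by_cases h : IsUnit V
  · have := h.invertible
    exact Matrix.blockTriangular_inv_of_blockTriangular hV
  · rw [Matrix.nonsing_inv_apply_not_isUnit V (by rwa [← Matrix.isUnit_iff_isUnit_det])]
    exact Matrix.blockTriangular_zero

theorem _root_.Matrix.BlockTriangular.isUnit {n : Type*} [Fintype n] [DecidableEq n] {b : n → α}
    (hb : Function.Injective b) {V : Matrix n n 𝕜} (hV : V.BlockTriangular b)
    (hdiag : ∀ i, V i i ≠ 0) : IsUnit V := by
  let _ : LinearOrder n := LinearOrder.lift' b hb
  rw [Matrix.isUnit_iff_isUnit_det, Matrix.det_of_isUpperTriangular (fun i j h => hV h)]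
  exact (Finset.prod_ne_zero_iff.mpr fun i _ => hdiag i).isUnit

/-! ### Pairs in terms of spans -/

/-- The rank characterization of persistence pairs: the pairing depends only on the spans of the
columns up to `t` and before `t`, not on the decomposition. -/
theorem isLow_mul_iff [Finite ρ] {D : Matrix ρ κ 𝕜} {V : Matrix κ κ 𝕜} {b : κ → α}
    (hb : Function.Injective b) (hu : IsUnit V) (hV : V.BlockTriangular b)
    (hR : IsReduced (D * V)) {σ : ρ} {t : κ} :
    IsLow (D * V) σ t ↔ HasLow D {c | b c ≤ b t} σ ∧ ¬ HasLow D {c | b c < b t} σ := by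
  have hVV : V * V⁻¹ = 1 := Matrix.mul_nonsing_inv V ((Matrix.isUnit_iff_isUnit_det V).mp hu)
  have hinv : ∀ v : κ → 𝕜, D.mulVec v = (D * V).mulVec (V⁻¹.mulVec v) := by
    intro v
    rw [Matrix.mulVec_mulVec, Matrix.mul_assoc, hVV, Matrix.mul_one]
  have hle : ∀ t i j : κ, b i ≤ b j → b j ≤ b t → b i ≤ b t := fun t i j => le_trans
  have hlt : ∀ t i j : κ, b i ≤ b j → b j < b t → b i < b t := fun t i j => lt_of_le_of_lt
  have hcol : ∀ j, IsLow (D * V) σ j → HasLow D {c | b c ≤ b j} σ := by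
    intro j hj
    refine ⟨V.mulVec (Pi.single j 1), hV.mulVec_eq_zero (hle j) ?_, ?_⟩
    · rintro k hk
      exact Pi.single_eq_of_ne (fun h : k = j => hk (h ▸ le_refl (b j))) _
    · rwa [Matrix.mulVec_mulVec, isLowVec_mulVec_single]
  constructor
  · refine fun h => ⟨hcol t h, ?_⟩
    rintro ⟨v, hv, hl⟩
    rw [hinv] at hl
    obtain ⟨j, hj0, hj⟩ := hR.exists_isLow hl
    obtain rfl := hR σ _ _ hj h
    exact hj0 (hV.inv.mulVec_eq_zero (hlt j) hv j (lt_irrefl (b j)))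
  · rintro ⟨⟨v, hv, hl⟩, hn⟩
    rw [hinv] at hl
    obtain ⟨j, hj0, hj⟩ := hR.exists_isLow hl
    have hjt : b j ≤ b t := by
      by_contra hc
      exact hj0 (hV.inv.mulVec_eq_zero (hle t) hv j hc)
    rcases hjt.lt_or_eq with h | h
    · exact absurd ((hcol j hj).mono fun c (hc : b c ≤ b j) => hc.trans_lt h) hn
    · rwa [← hb h]

/-- Among the vectors `e_t + v` with `v` supported strictly before `t`, take one whose image is zero
or else has the smallest possible low: no combination of the columns before `t` has the same low,
as it could be subtracted to decrease the low further. -/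
theorem exists_reduced_combination [Finite ρ] (D : Matrix ρ κ 𝕜) (b : κ → α) (t : κ) :
    ∃ v : κ → 𝕜, v t = 1 ∧ (∀ k, k ≠ t → ¬ b k < b t → v k = 0) ∧
      ∀ σ, IsLowVec (D.mulVec v) σ → ¬ HasLow D {c | b c < b t} σ := by
  classical
  let P : (κ → 𝕜) → Prop := fun v => v t = 1 ∧ ∀ k, k ≠ t → ¬ b k < b t → v k = 0
  by_cases h0 : ∃ v, P v ∧ D.mulVec v = 0
  · obtain ⟨v, hv, hv0⟩ := h0
    exact ⟨v, hv.1, hv.2, fun σ hσ => absurd (congrFun hv0 σ) hσ.1⟩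
  push Not at h0
  have hP : P (Pi.single t 1) := ⟨by simp, fun k hk _ => Pi.single_eq_of_ne hk _⟩
  have hne : {s | ∃ v, P v ∧ IsLowVec (D.mulVec v) s}.Nonempty := by
    obtain ⟨s, hs⟩ := exists_isLowVec (h0 _ hP)
    exact ⟨s, _, hP, hs⟩
  obtain ⟨s, ⟨v, hv, hs⟩, hmin⟩ := (Set.toFinite _).exists_minimal hne
  refine ⟨v, hv.1, hv.2, ?_⟩
  rintro σ hσ ⟨w, hw, hwl⟩
  obtain rfl := hs.unique hσ
  set a := D.mulVec v s / D.mulVec w s with ha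
  have hP' : P (v - a • w) := by
    refine ⟨by simp [hv.1, hw t (lt_irrefl (b t))], fun k hk hlt => ?_⟩
    simp [hv.2 k hk hlt, hw k hlt]
  have hmul : D.mulVec (v - a • w) = D.mulVec v - a • D.mulVec w := by
    rw [Matrix.mulVec_sub, Matrix.mulVec_smul]
  obtain ⟨q, hq⟩ := exists_isLowVec (h0 _ hP')
  have hqs : q < s := by
    by_contra hc
    apply hq.1
    rw [hmul]
    rcases (not_lt.mp hc).eq_or_lt with rfl | hlt
    · simp [ha, div_mul_cancel₀ _ hwl.1]
    · simp [hs.2 _ hlt, hwl.2 _ hlt]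
  exact (hmin ⟨_, hP', hq⟩ hqs.le).not_gt hqs

/-- Every order of the columns admits a decomposition, so that a pairing can be established without
running a reduction. -/
theorem exists_decomposition [Finite ρ] (D : Matrix ρ κ 𝕜) {b : κ → α}
    (hb : Function.Injective b) :
    ∃ V : Matrix κ κ 𝕜, IsUnit V ∧ V.BlockTriangular b ∧ IsReduced (D * V) := by
  choose v hv1 hv0 hv using exists_reduced_combination D b
  have hcol : ∀ σ t, IsLow (D * Matrix.of fun k t => v t k) σ t → IsLowVec (D.mulVec (v t)) σ :=
    fun σ t h => h
  have hno : ∀ σ t t', b t < b t' → IsLowVec (D.mulVec (v t)) σ →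
      ¬ IsLowVec (D.mulVec (v t')) σ := by
    refine fun σ t t' hlt h h' => hv t' σ h' ⟨v t, fun k hk => hv0 t k ?_ ?_, h⟩
    · rintro rfl
      exact hk hlt
    · exact fun hkt => hk (hkt.trans hlt)
  have htri : (Matrix.of fun k t => v t k).BlockTriangular b :=
    fun i j hji => hv0 j i (fun h => hji.ne (congrArg b h.symm)) hji.not_gt
  refine ⟨Matrix.of fun k t => v t k, htri.isUnit hb fun i => ?_, htri, fun σ t t' h h' => ?_⟩
  · simp [hv1]
  · rcases lt_trichotomy (b t) (b t') with hlt | heq | hlt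
    · exact absurd (hcol σ t' h') (hno σ t t' hlt (hcol σ t h))
    · exact hb heq
    · exact absurd (hcol σ t h) (hno σ t' t hlt (hcol σ t' h'))

/-- In a list of all columns, the pairing of `t` depends only on the set of columns in front of
it. -/
theorem paired_append_cons_iff [Finite ρ] {D : Matrix ρ κ 𝕜} {B C : List κ} {σ : ρ} {t : κ}
    (hall : ∀ c, c ∈ B ++ t :: C) (ht : t ∉ B) :
    Paired D (B ++ t :: C) σ t ↔
      HasLow D {c | c = t ∨ c ∈ B} σ ∧ ¬ HasLow D {c | c ∈ B} σ := by
  have hinj : Function.Injective fun c => (B ++ t :: C).idxOf c :=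
    fun c c' h => (List.idxOf_inj (hall c)).mp h
  have hlt : ∀ c, (B ++ t :: C).idxOf c < (B ++ t :: C).idxOf t ↔ c ∈ B := by
    intro c
    rw [List.idxOf_append_of_notMem ht, List.idxOf_cons_self, Nat.add_zero]
    constructor
    · intro h
      by_contra hc
      rw [List.idxOf_append_of_notMem hc] at h
      omega
    · intro h
      rw [List.idxOf_append_of_mem h]
      exact List.idxOf_lt_length_of_mem h
  have hset : {c | (B ++ t :: C).idxOf c < (B ++ t :: C).idxOf t} = {c | c ∈ B} :=
    Set.ext hlt
  have hset' : {c | (B ++ t :: C).idxOf c ≤ (B ++ t :: C).idxOf t} = {c | c = t ∨ c ∈ B} := by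
    ext c
    rw [Set.mem_ofPred_eq, Set.mem_ofPred_eq, le_iff_lt_or_eq, hlt, or_comm]
    exact or_congr_left ⟨fun h => hinj h, fun h => by rw [h]⟩
  constructor
  · rintro ⟨V, hu, hV, hR, hl⟩
    rw [isLow_mul_iff hinj hu hV hR, hset, hset'] at hl
    exact hl
  · intro h
    obtain ⟨V, hu, hV, hR⟩ := exists_decomposition D hinj
    refine ⟨V, hu, hV, hR, ?_⟩
    rw [isLow_mul_iff hinj hu hV hR, hset, hset']
    exact h

end Pairing


/-! ### The invariant of the lazy reduction -/

section Lazy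

variable {ρ κ 𝕜 : Type*} [LinearOrder ρ] [Fintype κ] [LinearOrder κ] [Field 𝕜]

/-- The invariant of the lazy reduction of `D` when the columns in `done` have been reduced and
those in `todo` are untouched. Laziness is the clause `low_gt`: a column `i` is only ever added to
a column `k` to cancel the current low of `k`, so its low lies below whatever remains of `k`. -/
structure LazyInvariant (D : Matrix ρ κ 𝕜) (done todo : Set κ) (M : Matrices ρ κ 𝕜) : Prop where
  eq_mul : D = M.R * M.U
  diag : ∀ i, M.U i i = 1
  upper : ∀ i k, k < i → M.U i k = 0
  untouched : ∀ k ∈ todo, ∀ i, i ≠ k → M.U i k = 0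
  low_gt : ∀ i k, i < k → M.U i k ≠ 0 → ∃ σ, IsLow M.R σ i ∧ ∀ σ', σ ≤ σ' → M.R σ' k = 0
  reduced : ∀ k ∈ done, ∀ i, i < k → ∀ σ, IsLow M.R σ i → ¬ IsLow M.R σ k

variable {D : Matrix ρ κ 𝕜}

theorem Matrices.addColumn_R_of_ne (M : Matrices ρ κ 𝕜) (σ : ρ) {i j k : κ} (h : k ≠ j) (s : ρ) :
    (M.addColumn σ i j).R s k = M.R s k := by
  simp [addColumn, h]

theorem Matrices.addColumn_R_self (M : Matrices ρ κ 𝕜) (σ : ρ) (i j : κ) (s : ρ) :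
    (M.addColumn σ i j).R s j = M.R s j - M.R σ j / M.R σ i * M.R s i := by
  simp [addColumn]

theorem Matrices.addColumn_U_of_ne (M : Matrices ρ κ 𝕜) (σ : ρ) {i j l : κ} (h : l ≠ i) (k : κ) :
    (M.addColumn σ i j).U l k = M.U l k := by
  simp [addColumn, h]

theorem Matrices.addColumn_U_self (M : Matrices ρ κ 𝕜) (σ : ρ) (i j k : κ) :
    (M.addColumn σ i j).U i k = M.U i k + M.R σ j / M.R σ i * M.U j k := by
  simp [addColumn]

theorem Matrices.addColumn_R_mul_U (M : Matrices ρ κ 𝕜) (σ : ρ) {i j : κ} (hij : i ≠ j) :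
    (M.addColumn σ i j).R * (M.addColumn σ i j).U = M.R * M.U := by
  ext s c
  have h : ∀ k, (M.addColumn σ i j).R s k * (M.addColumn σ i j).U k c = M.R s k * M.U k c
      + ((if k = i then M.R s i * (M.R σ j / M.R σ i * M.U j c) else 0)
        - (if k = j then M.R σ j / M.R σ i * M.R s i * M.U j c else 0)) := by
    intro k
    by_cases hki : k = i
    · subst hki
      rw [M.addColumn_R_of_ne σ hij, M.addColumn_U_self]
      simp [hij]
      ring
    · rw [M.addColumn_U_of_ne σ hki]
      by_cases hkj : k = j
      · subst hkj
        rw [M.addColumn_R_self]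
        simp [hki]
        ring
      · rw [M.addColumn_R_of_ne σ hkj]
        simp [hki, hkj]
  rw [Matrix.mul_apply, Matrix.mul_apply, Finset.sum_congr rfl fun k _ => h k,
    Finset.sum_add_distrib, Finset.sum_sub_distrib]
  simp
  ring

theorem LazyInvariant.addColumn {j : κ} {M : Matrices ρ κ 𝕜}
    (h : LazyInvariant D (Set.Iio j) (Set.Ioi j) M) {i : κ} {σ : ρ} (hij : i < j)
    (hi : IsLow M.R σ i) (hj : IsLow M.R σ j) :
    LazyInvariant D (Set.Iio j) (Set.Ioi j) (M.addColumn σ i j) := by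
  -- Row `j` of `U` is still a unit vector, so only the entry `U i j` changes.
  have hU : ∀ l k, ¬ (l = i ∧ k = j) → (M.addColumn σ i j).U l k = M.U l k := by
    intro l k hlk
    by_cases hl : l = i
    · subst hl
      have hkj : k ≠ j := fun hk => hlk ⟨rfl, hk⟩
      have : M.U j k = 0 := by
        rcases hkj.lt_or_gt with hk | hk
        · exact h.upper j k hk
        · exact h.untouched k hk j hk.ne
      rw [M.addColumn_U_self, this, mul_zero, add_zero]
    · exact M.addColumn_U_of_ne σ hl k
  have hlow : ∀ l, l ≠ j → ∀ s, IsLow (M.addColumn σ i j).R s l ↔ IsLow M.R s l := by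
    intro l hl s
    simp only [IsLow, M.addColumn_R_of_ne σ hl]
  have hzero : ∀ s, σ ≤ s → (M.addColumn σ i j).R s j = 0 := by
    intro s hs
    rw [M.addColumn_R_self]
    rcases hs.eq_or_lt with rfl | hs
    · simp [div_mul_cancel₀ _ hi.1]
    · simp [hi.2 _ hs, hj.2 _ hs]
  refine ⟨?_, fun l => ?_, fun l k hk => ?_, fun k hk l hl => ?_, fun l k hlk hne => ?_,
    fun k hk l hl s => ?_⟩
  · rw [M.addColumn_R_mul_U σ hij.ne]
    exact h.eq_mul
  · rw [hU l l (fun hc => hij.ne (hc.1.symm.trans hc.2)), h.diag]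
  · rw [hU l k (fun hc => (hc.1 ▸ hc.2 ▸ hk).not_gt hij), h.upper l k hk]
  · rw [hU l k (fun hc => (Set.mem_Ioi.mp hk).ne' hc.2), h.untouched k hk l hl]
  · by_cases hkj : k = j
    · subst hkj
      by_cases hli : l = i
      · subst hli
        exact ⟨σ, (hlow l hij.ne σ).mpr hi, hzero⟩
      · rw [hU l k (fun hc => hli hc.1)] at hne
        obtain ⟨s, hs, hs0⟩ := h.low_gt l k hlk hne
        have hσs : σ < s := by
          by_contra hc
          exact hj.1 (hs0 σ (not_lt.mp hc))
        exact ⟨s, (hlow l hlk.ne s).mpr hs, fun s' hs' => hzero s' (hσs.le.trans hs')⟩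
    · rw [hU l k (fun hc => hkj hc.2)] at hne
      have hlj : l ≠ j := by
        rintro rfl
        exact hne (h.untouched k hlk l hlk.ne)
      obtain ⟨s, hs, hs0⟩ := h.low_gt l k hlk hne
      refine ⟨s, (hlow l hlj s).mpr hs, fun s' hs' => ?_⟩
      rw [M.addColumn_R_of_ne σ hkj, hs0 s' hs']
  · rw [hlow l (hl.trans hk).ne, hlow k (ne_of_lt hk)]
    exact h.reduced k hk l hl s

theorem LazyInvariant.whileLoop {j : κ} {M M' : Matrices ρ κ 𝕜} (hw : WhileLoop j M M')
    (h : LazyInvariant D (Set.Iio j) (Set.Ioi j) M) :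
    LazyInvariant D (Set.Iic j) (Set.Ioi j) M' := by
  induction hw with
  | done M hend =>
    refine { h with reduced := fun k hk i hik σ hi hk' => ?_ }
    rcases (Set.mem_Iic.mp hk).lt_or_eq with hlt | rfl
    · exact h.reduced k hlt i hik σ hi hk'
    · exact hend ⟨i, σ, hik, hi, hk'⟩
  | step M M' i σ hij hi hj _ ih => exact ih (h.addColumn hij hi hj)

theorem LazyInvariant.forLoop {l : List κ} {M M' : Matrices ρ κ 𝕜} (hl : ForLoop l M M')
    (hsort : l.Pairwise (· < ·)) (hup : ∀ k ∈ l, ∀ k', k < k' → k' ∈ l)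
    (h : LazyInvariant D {k | k ∉ l} {k | k ∈ l} M) :
    LazyInvariant D Set.univ ∅ M' := by
  induction hl with
  | nil M => simpa using h
  | cons j l M M' M'' hw _ ih =>
    rw [List.pairwise_cons] at hsort
    have hmem : ∀ k, k ∈ l ↔ j < k := by
      refine fun k => ⟨hsort.1 k, fun hk => ?_⟩
      rcases List.mem_cons.mp (hup j List.mem_cons_self k hk) with rfl | h'
      · exact absurd hk (lt_irrefl _)
      · exact h'
    have hdone : {k | k ∉ j :: l} = Set.Iio j := by
      ext k
      rw [Set.mem_ofPred_eq, List.mem_cons, hmem, Set.mem_Iio, eq_comm, ← le_iff_eq_or_lt, not_le]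
    have hdone' : {k | k ∉ l} = Set.Iic j := by
      ext k
      simp [hmem]
    have htodo : {k | k ∈ l} = Set.Ioi j := Set.ext hmem
    refine ih hsort.2 (fun k hk k' hkk' => (hmem k').mpr (((hmem k).mp hk).trans hkk')) ?_
    rw [hdone', htodo]
    refine LazyInvariant.whileLoop hw ?_
    rw [hdone] at h
    exact { h with
      untouched := fun k hk => h.untouched k (List.mem_cons_of_mem _ ((hmem k).mpr hk)) }

theorem pairwise_columns : (columns κ).Pairwise (· < ·) :=
  (Finset.sortedLT_sort _).pairwise

theorem mem_columns (k : κ) : k ∈ columns κ := by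
  simp [columns]

theorem IsLazyReduction.lazyInvariant {M : Matrices ρ κ 𝕜} (h : IsLazyReduction D M) :
    LazyInvariant D Set.univ ∅ M := by
  refine LazyInvariant.forLoop h pairwise_columns (fun _ _ k _ => mem_columns k) ?_
  refine ⟨by simp, by simp, fun i k hk => Matrix.one_apply_ne hk.ne', fun k _ i hi =>
    Matrix.one_apply_ne hi, fun i k hik hne => absurd (Matrix.one_apply_ne hik.ne) hne,
    fun k hk => absurd (mem_columns k) hk⟩

/-! ### One row of `U` decides which combinations have low `σ` -/

variable {M : Matrices ρ κ 𝕜}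

theorem LazyInvariant.isReduced {s : Set κ} (h : LazyInvariant D Set.univ s M) :
    IsReduced M.R := by
  intro σ i k hi hk
  rcases lt_trichotomy i k with hlt | heq | hlt
  · exact absurd hk (h.reduced k trivial i hlt σ hi)
  · exact heq
  · exact absurd hi (h.reduced i trivial k hlt σ hk)

theorem LazyInvariant.blockTriangular {s s' : Set κ} (h : LazyInvariant D s s' M) :
    M.U.BlockTriangular id :=
  fun i k hk => h.upper i k hk

theorem LazyInvariant.isUnit {s s' : Set κ} (h : LazyInvariant D s s' M) : IsUnit M.U :=
  h.blockTriangular.isUnit Function.injective_id fun i => by simp [h.diag i]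

theorem LazyInvariant.R_eq {s s' : Set κ} (h : LazyInvariant D s s' M) : M.R = D * M.U⁻¹ := by
  rw [h.eq_mul, Matrix.mul_assoc,
    Matrix.mul_nonsing_inv _ ((Matrix.isUnit_iff_isUnit_det _).mp h.isUnit), Matrix.mul_one]

/-- A combination of columns in which the reduced column `τ` does not occur has a low other than
that of `τ`. -/
theorem LazyInvariant.not_hasLow [Finite ρ] {s : Set κ} (h : LazyInvariant D Set.univ s M) {σ : ρ}
    {τ : κ} (hτ : IsLow M.R σ τ) {A : Set κ} (hA : ∀ k ∈ A, M.U τ k = 0) : ¬ HasLow D A σ := by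
  rintro ⟨v, hv, hl⟩
  rw [h.eq_mul, ← Matrix.mulVec_mulVec] at hl
  obtain ⟨j, hj0, hj⟩ := h.isReduced.exists_isLow hl
  obtain rfl := h.isReduced σ _ _ hj hτ
  refine hj0 (Finset.sum_eq_zero fun k _ => ?_)
  by_cases hk : k ∈ A
  · simp [hA k hk]
  · simp [hv k hk]

/-- By laziness, the reduced columns that reach below row `σ` are combinations of columns of `D`
with a zero entry in row `τ` of `U`. -/
theorem LazyInvariant.inv_apply_eq_zero {s s' : Set κ} (h : LazyInvariant D s s' M) {σ : ρ}
    {τ : κ} (hτ : IsLow M.R σ τ) {l : κ} (hl : M.U τ l ≠ 0) (i : κ)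
    (hi : ∃ q, σ < q ∧ M.R q i ≠ 0) : M.U⁻¹ l i = 0 := by
  induction i using WellFoundedLT.induction with
  | ind i ih =>
    obtain ⟨q, hq, hne⟩ := hi
    have hli : l ≠ i := by
      rintro rfl
      rcases lt_trichotomy τ l with hlt | rfl | hlt
      · obtain ⟨σ', hσ', hz⟩ := h.low_gt τ l hlt hl
        obtain rfl : σ' = σ := IsLowVec.unique (w := fun q => M.R q τ) hσ' hτ
        exact hne (hz q hq.le)
      · exact hne (hτ.2 q hq)
      · exact hl (h.upper τ l hlt)
    have hmul : (M.U⁻¹ * M.U) l i = 0 := by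
      rw [Matrix.nonsing_inv_mul _ ((Matrix.isUnit_iff_isUnit_det _).mp h.isUnit)]
      exact Matrix.one_apply_ne hli
    rw [Matrix.mul_apply, Finset.sum_eq_single i, h.diag, mul_one] at hmul
    · exact hmul
    · intro j _ hji
      by_cases hj0 : M.U j i = 0
      · simp [hj0]
      · have hlt : j < i := by
          by_contra hc
          exact hj0 (h.upper j i (lt_of_le_of_ne (not_lt.mp hc) hji.symm))
        obtain ⟨σ', hσ', hz⟩ := h.low_gt j i hlt hj0
        have hqσ' : q < σ' := by
          by_contra hc
          exact hne (hz q (not_lt.mp hc))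
        rw [ih j hlt ⟨σ', hq.trans hqσ', hσ'.1⟩, zero_mul]
    · simp

/-- If `U τ t ≠ 0`, then column `t` together with the earlier columns whose entry in row `τ` of `U`
vanishes yields the low of `τ`. -/
theorem LazyInvariant.hasLow [Finite ρ] {s : Set κ} (h : LazyInvariant D Set.univ s M) {σ : ρ}
    {τ : κ} (hτ : IsLow M.R σ τ) {t : κ} (ht : M.U τ t ≠ 0) :
    HasLow D {c | c = t ∨ c < t ∧ M.U τ c = 0} σ := by
  classical
  -- Of the expansion of column `t` in reduced columns, drop those that reach below row `σ`.
  let u : κ → 𝕜 := fun i => if ∃ q, σ < q ∧ M.R q i ≠ 0 then 0 else M.U i t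
  have hτu : u τ = M.U τ t := by
    refine if_neg ?_
    rintro ⟨q, hq, hne⟩
    exact hne (hτ.2 q hq)
  have hu : ∀ i, u i ≠ 0 → ∀ q, σ < q → M.R q i = 0 := by
    intro i hi q hq
    by_contra hne
    exact hi (if_pos ⟨q, hq, hne⟩)
  refine ⟨M.U⁻¹.mulVec u, fun k hk => ?_, ?_⟩
  · rw [Set.mem_ofPred_eq, not_or, not_and] at hk
    rcases lt_or_gt_of_ne hk.1 with hlt | hlt
    · have hmul : (M.U⁻¹ * M.U) k t = 0 := by
        rw [Matrix.nonsing_inv_mul _ ((Matrix.isUnit_iff_isUnit_det _).mp h.isUnit)]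
        exact Matrix.one_apply_ne hk.1
      rw [← hmul]
      refine Finset.sum_congr rfl fun i _ => ?_
      by_cases hi : ∃ q, σ < q ∧ M.R q i ≠ 0
      · simp [h.inv_apply_eq_zero hτ (hk.2 hlt) i hi]
      · simp [u, hi]
    · refine h.blockTriangular.inv.mulVec_eq_zero (A := Set.Iic t)
        (fun i j hij hj => le_trans hij hj) (fun i hi => ?_) k (not_le.mpr hlt)
      simp [u, h.upper i t (not_le.mp hi)]
  · have hR : D.mulVec (M.U⁻¹.mulVec u) = M.R.mulVec u := by
      rw [Matrix.mulVec_mulVec, ← h.R_eq]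
    rw [hR]
    constructor
    · have : M.R.mulVec u σ = M.R σ τ * u τ := by
        refine Finset.sum_eq_single τ (fun i _ hi => ?_) (by simp)
        by_cases hui : u i = 0
        · simp [hui]
        · have : M.R σ i = 0 := by
            by_contra hne
            exact hi (h.isReduced σ i τ ⟨hne, hu i hui⟩ hτ)
          simp [this]
      rw [this, hτu]
      exact mul_ne_zero hτ.1 ht
    · refine fun q hq => Finset.sum_eq_zero fun i _ => ?_
      by_cases hui : u i = 0
      · simp [hui]
      · simp [hu i hui q hq]

/-- The pairs of the original order are the lows of `R`: the inverse of `U` is an admissible change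
of columns. -/
theorem LazyInvariant.isLow_of_paired [Finite ρ] {s : Set κ} (h : LazyInvariant D Set.univ s M)
    {σ : ρ} {τ : κ} (hp : Paired D (columns κ) σ τ) : IsLow M.R σ τ := by
  obtain ⟨B, C, hBC⟩ := List.append_of_mem (mem_columns τ)
  have hsort := pairwise_columns (κ := κ)
  rw [hBC, List.pairwise_append, List.pairwise_cons] at hsort
  have hall : ∀ c, c ∈ B ++ τ :: C := fun c => hBC ▸ mem_columns c
  have hB : ∀ c, c ∈ B ↔ c < τ := by
    refine fun c => ⟨fun hc => hsort.2.2 c hc τ List.mem_cons_self, fun hc => ?_⟩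
    rcases List.mem_append.mp (hall c) with h' | h'
    · exact h'
    · rcases List.mem_cons.mp h' with rfl | h'
      · exact absurd hc (lt_irrefl _)
      · exact absurd hc (hsort.2.1.1 c h').not_gt
  rw [hBC, paired_append_cons_iff hall (fun hc => lt_irrefl _ ((hB τ).mp hc))] at hp
  have hred := h.isReduced
  rw [h.R_eq] at hred ⊢
  rw [isLow_mul_iff Function.injective_id
    (Matrix.isUnit_nonsing_inv_iff.mpr h.isUnit) h.blockTriangular.inv hred]
  have h1 : {c | c = τ ∨ c ∈ B} = {c | id c ≤ id τ} := by
    ext c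
    simp [hB, le_iff_eq_or_lt]
  have h2 : {c | c ∈ B} = {c | id c < id τ} := Set.ext hB
  rwa [h1, h2] at hp

/-- The entry `U τ t` decides the pairing of `t` with the low `σ` of `τ`, whenever the columns
before `t` are zeros of row `τ` of `U`, and include all such columns that precede `t` in the given
order. -/
theorem LazyInvariant.paired_iff [Finite ρ] {s : Set κ} (h : LazyInvariant D Set.univ s M)
    {σ : ρ} {τ t : κ} (hτ : IsLow M.R σ τ) {B C : List κ} (hall : ∀ c, c ∈ B ++ t :: C)
    (htB : t ∉ B) (hB : ∀ c ∈ B, M.U τ c = 0) (hB' : ∀ c, c < t → M.U τ c = 0 → c ∈ B) :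
    Paired D (B ++ t :: C) σ t ↔ M.U τ t ≠ 0 := by
  rw [paired_append_cons_iff hall htB]
  constructor
  · rintro ⟨hl, -⟩ h0
    refine h.not_hasLow hτ ?_ hl
    rintro k (rfl | hk)
    · exact h0
    · exact hB k hk
  · refine fun ht => ⟨(h.hasLow hτ ht).mono ?_, h.not_hasLow hτ hB⟩
    rintro c (hc | ⟨hct, hc0⟩)
    · exact Or.inl hc
    · exact Or.inr (hB' c hct hc0)

end Lazy


/-! ### The transposition procedure -/

section Procedure

variable {ρ κ 𝕜 : Type*} [LinearOrder ρ] [Fintype κ] [LinearOrder κ] [Field 𝕜]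

open Classical in
/-- The state of the transposition procedure after the columns in `l` have been treated, as
predicted by the row `u`: columns with a zero entry have been moved in front of the block and the
others have joined it. -/
noncomputable def Sweep.predicted (u : κ → 𝕜) (τ : κ) (l : List κ) : Sweep κ where
  before := (columns κ).filter (fun t => t < τ) ++ l.filter (fun t => u t = 0)
  crit := τ :: l.filter (fun t => u t ≠ 0)
  after := ((columns κ).filter (fun t => τ < t)).diff l

theorem mem_met {f : κ → ℝ} {τ t : κ} {d' : ℝ} :
    t ∈ met f τ d' ↔ τ < t ∧ f τ ≤ f t ∧ f t ≤ d' := by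
  simp [met, mem_columns]

theorem pairwise_met (f : κ → ℝ) (τ : κ) (d' : ℝ) : (met f τ d').Pairwise (· < ·) :=
  pairwise_columns.filter _

theorem mem_met_of_lt {f : κ → ℝ} (hf : Monotone f) {τ t c : κ} {d' : ℝ} (hτc : τ < c)
    (hct : c < t) (ht : t ∈ met f τ d') : c ∈ met f τ d' :=
  mem_met.mpr ⟨hτc, hf hτc.le, (hf hct.le).trans (mem_met.mp ht).2.2⟩

theorem nodup_columns : (columns κ).Nodup :=
  pairwise_columns.imp fun h => ne_of_lt h

theorem Sweep.mem_predicted_before {u : κ → 𝕜} {τ c : κ} {l : List κ} :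
    c ∈ (predicted u τ l).before ↔ c < τ ∨ (c ∈ l ∧ u c = 0) := by
  simp [predicted, mem_columns]

theorem Sweep.mem_predicted_crit {u : κ → 𝕜} {τ c : κ} {l : List κ} :
    c ∈ (predicted u τ l).crit ↔ c = τ ∨ (c ∈ l ∧ u c ≠ 0) := by
  simp [predicted]

theorem Sweep.mem_predicted_after {u : κ → 𝕜} {τ c : κ} {l : List κ} :
    c ∈ (predicted u τ l).after ↔ τ < c ∧ c ∉ l := by
  have := (nodup_columns (κ := κ)).filter fun t => decide (τ < t)
  simp [predicted, this.mem_sdiff_iff, mem_columns]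

theorem Sweep.predicted_exhaustive (u : κ → 𝕜) (τ : κ) (l : List κ) (c : κ) :
    c ∈ (predicted u τ l).before ∨ c ∈ (predicted u τ l).crit ∨ c ∈ (predicted u τ l).after := by
  rw [mem_predicted_before, mem_predicted_crit, mem_predicted_after]
  have := lt_trichotomy c τ
  tauto

theorem Sweep.start_eq_predicted (u : κ → 𝕜) (τ : κ) : start τ = predicted u τ [] := by
  simp [start, predicted]

variable {D : Matrix ρ κ 𝕜} {M : Matrices ρ κ 𝕜} {s : Set κ} {σ : ρ} {τ : κ} {f : κ → ℝ} {d' : ℝ}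

theorem LazyInvariant.predicted_before_eq_zero (h : LazyInvariant D Set.univ s M) {l : List κ}
    {c : κ} (hc : c ∈ (Sweep.predicted (M.U τ) τ l).before) : M.U τ c = 0 := by
  rcases Sweep.mem_predicted_before.mp hc with hc | hc
  · exact h.upper τ c hc
  · exact hc.2

theorem LazyInvariant.paired_past_iff [Finite ρ] (h : LazyInvariant D Set.univ s M)
    (hτ : IsLow M.R σ τ) (hf : Monotone f) {l₁ l₂ L : List κ} {t : κ}
    (hmet : met f τ d' = l₁ ++ t :: l₂) (hL : L.Perm (Sweep.predicted (M.U τ) τ l₁).crit) :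
    Paired D ((Sweep.predicted (M.U τ) τ l₁).past t L) σ t ↔ M.U τ t ≠ 0 := by
  have htmet : t ∈ met f τ d' := by simp [hmet]
  have hτt := (mem_met.mp htmet).1
  have hsort := pairwise_met f τ d'
  rw [hmet, List.pairwise_append, List.pairwise_cons] at hsort
  have htl : t ∉ l₁ := fun ht => lt_irrefl t (hsort.2.2 t ht t List.mem_cons_self)
  refine h.paired_iff hτ (fun c => ?_) (fun hc => ?_) (fun c hc => h.predicted_before_eq_zero hc)
    (fun c hct hc0 => ?_)
  · rw [List.mem_append, List.mem_cons, List.mem_append, hL.mem_iff]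
    rcases Sweep.predicted_exhaustive (M.U τ) τ l₁ c with hc | hc | hc
    · exact Or.inl hc
    · exact Or.inr (Or.inr (Or.inl hc))
    · by_cases hct : c = t
      · exact Or.inr (Or.inl hct)
      · exact Or.inr (Or.inr (Or.inr ((List.mem_erase_of_ne hct).mpr hc)))
  · rcases Sweep.mem_predicted_before.mp hc with hc | hc
    · exact hτt.not_gt hc
    · exact htl hc.1
  · rw [Sweep.mem_predicted_before]
    rcases lt_trichotomy c τ with hlt | rfl | hlt
    · exact Or.inl hlt
    · rw [h.diag] at hc0
      exact absurd hc0 one_ne_zero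
    · have hcm := mem_met_of_lt hf hlt hct htmet
      rw [hmet, List.mem_append, List.mem_cons] at hcm
      rcases hcm with hcm | hcm | hcm
      · exact Or.inr ⟨hcm, hc0⟩
      · exact absurd hcm hct.ne
      · exact absurd hct (hsort.2.1.1 c hcm).not_gt

theorem LazyInvariant.run_eq_predicted [Finite ρ] (h : LazyInvariant D Set.univ s M)
    (hτ : IsLow M.R σ τ) (hf : Monotone f) (l₁ : List κ) :
    ∀ l₂, met f τ d' = l₁ ++ l₂ → Sweep.run D σ τ l₁ = Sweep.predicted (M.U τ) τ l₁ := by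
  induction l₁ using List.reverseRecOn with
  | nil => exact fun _ _ => Sweep.start_eq_predicted _ τ
  | append_singleton l t ih =>
    intro l₂ hmet
    rw [List.append_assoc, List.singleton_append] at hmet
    have hrun : Sweep.run D σ τ (l ++ [t]) = Sweep.step D σ (Sweep.run D σ τ l) t := by
      simp [Sweep.run]
    have hafter : (Sweep.predicted (M.U τ) τ (l ++ [t])).after
        = (Sweep.predicted (M.U τ) τ l).after.erase t := by
      simp [Sweep.predicted, List.diff_append]
    have hiff := h.paired_past_iff hτ hf hmet (List.Perm.refl _)
    rw [hrun, ih _ hmet, Sweep.step]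
    split_ifs with hp
    · rw [← hafter]
      simp [Sweep.predicted, hiff.mp hp]
    · rw [← hafter]
      simp [Sweep.predicted, not_not.mp (mt hiff.mpr hp)]

theorem LazyInvariant.mem_predicted_crit_iff (h : LazyInvariant D Set.univ s M)
    (hd' : f τ ≤ d') (t : κ) : t ∈ (Sweep.predicted (M.U τ) τ (met f τ d')).crit ↔
      f τ ≤ f t ∧ f t ≤ d' ∧ M.U τ t ≠ 0 := by
  rw [Sweep.mem_predicted_crit, mem_met]
  constructor
  · rintro (rfl | ht)
    · exact ⟨le_rfl, hd', by simp [h.diag]⟩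
    · exact ⟨ht.1.2.1, ht.1.2.2, ht.2⟩
  · rintro ⟨h1, h2, h3⟩
    rcases lt_trichotomy t τ with hlt | heq | hlt
    · exact absurd (h.upper τ t hlt) h3
    · exact Or.inl heq
    · exact Or.inr ⟨⟨hlt, h1, h2⟩, h3⟩

theorem LazyInvariant.isCritical_predicted [Finite ρ] (h : LazyInvariant D Set.univ s M)
    (hτ : IsLow M.R σ τ) (hf : Monotone f) (hd' : f τ ≤ d') :
    (Sweep.predicted (M.U τ) τ (met f τ d')).IsCritical D σ := by
  intro x L hperm
  have hx := (h.mem_predicted_crit_iff hd' x).mp (hperm.mem_iff.mp List.mem_cons_self)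
  rw [List.append_assoc, List.cons_append]
  refine (h.paired_iff hτ (fun c => ?_) (fun hc => ?_) (fun c hc => h.predicted_before_eq_zero hc)
    (fun c hcx hc0 => ?_)).mpr hx.2.2
  · rw [← List.cons_append, List.mem_append, List.mem_append, hperm.mem_iff]
    exact Sweep.predicted_exhaustive _ _ _ _
  · exact hx.2.2 (h.predicted_before_eq_zero hc)
  · rw [Sweep.mem_predicted_before]
    rcases lt_trichotomy c τ with hlt | rfl | hlt
    · exact Or.inl hlt
    · rw [h.diag] at hc0
      exact absurd hc0 one_ne_zero
    · exact Or.inr ⟨mem_met.mpr ⟨hlt, hf hlt.le, (hf hcx.le).trans hx.2.1⟩, hc0⟩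

end Procedure

/-! ### The scan -/

section Scan

variable {κ 𝕜 : Type*} [Zero 𝕜]

/-- The scan of a list with non-decreasing values appends the columns within the bound that have a
non-zero entry, using at most four steps for each column within the bound and two to halt. -/
theorem Scan.exists_halt (f : κ → ℝ) (d' : ℝ) (u : κ → 𝕜) (todo : List κ) :
    todo.Pairwise (fun a b => f a ≤ f b) → ∀ out : List κ, (todo ++ out).Nodup →
    ∃ (N : ℕ) (out' : List κ), N ≤ 4 * (todo.filter (fun t => f t ≤ d')).length + 2 ∧
      (Scan.step f d' u)^[N] (.next todo out) = .halt out' ∧ out'.Nodup ∧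
      ∀ t, t ∈ out' ↔ t ∈ out ∨ (t ∈ todo ∧ f t ≤ d' ∧ u t ≠ 0) := by
  induction todo with
  | nil =>
    intro _ out hnd
    exact ⟨1, out, by simp, rfl, by simpa using hnd, by simp⟩
  | cons a todo ih =>
    intro hs out hnd
    rw [List.pairwise_cons] at hs
    rw [List.cons_append, List.nodup_cons, List.mem_append, not_or] at hnd
    by_cases ha : f a ≤ d'
    · have hlen : ((a :: todo).filter (fun t => f t ≤ d')).length
          = (todo.filter (fun t => f t ≤ d')).length + 1 := by
        simp [ha]
      by_cases hu : u a = 0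
      · obtain ⟨N, out', hN, hrun, hnd', hmem⟩ := ih hs.2 out hnd.2
        refine ⟨N + 3, out', by omega, ?_, hnd', fun t => ?_⟩
        · rw [Function.iterate_add_apply, ← hrun]
          simp [Scan.step, ha, hu]
        · rw [hmem, List.mem_cons]
          constructor
          · tauto
          · rintro (h | ⟨rfl | h, h1, h2⟩)
            · exact Or.inl h
            · exact absurd hu h2
            · exact Or.inr ⟨h, h1, h2⟩
      · have hnd2 : (todo ++ a :: out).Nodup :=
          List.nodup_middle.mpr (List.nodup_cons.mpr ⟨by simpa using hnd.1, hnd.2⟩)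
        obtain ⟨N, out', hN, hrun, hnd', hmem⟩ := ih hs.2 (a :: out) hnd2
        refine ⟨N + 4, out', by omega, ?_, hnd', fun t => ?_⟩
        · rw [Function.iterate_add_apply, ← hrun]
          simp [Scan.step, ha, hu]
        · rw [hmem, List.mem_cons, List.mem_cons]
          constructor
          · rintro ((rfl | h) | h)
            · exact Or.inr ⟨Or.inl rfl, ha, hu⟩
            · exact Or.inl h
            · exact Or.inr ⟨Or.inr h.1, h.2⟩
          · tauto
    · refine ⟨2, out, by omega, by simp [Scan.step, ha], hnd.2.of_append_right, fun t => ?_⟩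
      refine ⟨Or.inl, ?_⟩
      rintro (h | ⟨h, h1, -⟩)
      · exact h
      · rcases List.mem_cons.mp h with rfl | h
        · exact absurd h1 ha
        · exact absurd ((hs.1 t h).trans h1) ha

end Scan

theorem Filtration.monotone_val {V : Type*} {K : PreAbstractSimplicialComplex V} (F : Filtration K)
    (c : ℕ) : Monotone (fun s : F.Cell c => F.val s) := by
  intro s t hst
  have := F.sorted (F.simplex.symm s.1) (F.simplex.symm t.1) hst
  simpa [Filtration.val] using this

end Persistence

open Persistence in
theorem mainTheorem1 {V : Type*} [LinearOrder V] {𝕜 : Type*} [Field 𝕜]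
    (K : PreAbstractSimplicialComplex V) (F : Filtration K) (p : ℕ)
    (M : Matrices (F.Cell p) (F.Cell (p + 1)) 𝕜)
    (hM : IsLazyReduction (F.boundary 𝕜 p) M)
    (σ : F.Cell p) (τ : F.Cell (p + 1))
    (hpair : Paired (F.boundary 𝕜 p) (columns (F.Cell (p + 1))) σ τ)
    (d' : ℝ) (hd' : F.val τ ≤ d') :
    -- the accumulated set
    (∀ t, t ∈ (Sweep.run (F.boundary 𝕜 p) σ τ (met F.val τ d')).crit ↔
      F.val τ ≤ F.val t ∧ F.val t ≤ d' ∧ M.U τ t ≠ 0) ∧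
    -- it is critical in the final order
    (Sweep.run (F.boundary 𝕜 p) σ τ (met F.val τ d')).IsCritical (F.boundary 𝕜 p) σ ∧
    -- at each stage, all orders of the critical set give the same answer, an entry of one row
    (∀ (l₁ : List (F.Cell (p + 1))) (t : F.Cell (p + 1)) (l₂ : List (F.Cell (p + 1))),
      met F.val τ d' = l₁ ++ t :: l₂ →
      ∀ L : List (F.Cell (p + 1)), L.Perm (Sweep.run (F.boundary 𝕜 p) σ τ l₁).crit →
        (Paired (F.boundary 𝕜 p) ((Sweep.run (F.boundary 𝕜 p) σ τ l₁).past t L) σ t ↔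
          M.U τ t ≠ 0)) ∧
    -- scanning the row of `τ` from `τ` on finds the set in linear time
    (∃ (N : ℕ) (out : List (F.Cell (p + 1))),
      N ≤ 4 * (Finset.univ.filter
        (fun t : F.Cell (p + 1) => F.val τ ≤ F.val t ∧ F.val t ≤ d')).card + 2 ∧
      (Scan.step F.val d' (M.U τ))^[N]
        (.next ((columns (F.Cell (p + 1))).filter (fun t => τ ≤ t)) []) = .halt out ∧
      out.Nodup ∧
      ∀ t, t ∈ out ↔ t ∈ (Sweep.run (F.boundary 𝕜 p) σ τ (met F.val τ d')).crit) := by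
  have h := hM.lazyInvariant
  have hf := F.monotone_val (p + 1)
  have hτ := h.isLow_of_paired hpair
  have hrun := h.run_eq_predicted (d' := d') hτ hf (met F.val τ d') [] (by simp)
  have hmem := h.mem_predicted_crit_iff hd'
  refine ⟨?_, ?_, ?_, ?_⟩
  · rw [hrun]
    exact hmem
  · rw [hrun]
    exact h.isCritical_predicted hτ hf hd'
  · intro l₁ t l₂ hmet L hL
    rw [h.run_eq_predicted hτ hf l₁ _ hmet] at hL ⊢
    exact h.paired_past_iff hτ hf hmet hL
  · have hnd : ((columns (F.Cell (p + 1))).filter (fun t => τ ≤ t)).Nodup := nodup_columns.filter _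
    obtain ⟨N, out, hN, hstep, hout, hiff⟩ := Scan.exists_halt F.val d' (M.U τ)
      ((columns (F.Cell (p + 1))).filter (fun t => τ ≤ t))
      ((pairwise_columns.filter _).imp fun hab => hf hab.le) [] (by simpa using hnd)
    refine ⟨N, out, hN.trans ?_, hstep, hout, fun t => ?_⟩
    · gcongr
      rw [← List.toFinset_card_of_nodup (hnd.filter _)]
      refine Finset.card_le_card fun t ht => ?_
      simp only [List.mem_toFinset, List.mem_filter, decide_eq_true_eq] at ht
      simpa using ⟨hf ht.1.2, ht.2⟩
    · rw [hrun, hmem, hiff]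
      constructor
      · rintro (ht | ⟨ht, h1, h2⟩)
        · simp at ht
        · have hle : τ ≤ t := by simpa [mem_columns] using ht
          exact ⟨hf hle, h1, h2⟩
      · rintro ⟨h1, h2, h3⟩
        have hle : τ ≤ t := by
          by_contra hc
          exact h3 (h.upper τ t (not_le.mp hc))
        exact Or.inr ⟨by simpa [mem_columns] using hle, h2, h3⟩
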